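/- Let $X=(X_1,\dots,X_p)$ be a random vector in $\mathbb R^p$ whose law $P_X$ is absolutely continuous with respect to Lebesgue measure; let $V$, $\mathrm{Cov}$, $\mathbb E$ be taken with respect to $P_X$, and let $S$ be the set of nonempty subsets of $\{1,\dots,p\}$. For each $i$ let $\tilde k^i$ be a covariance kernel on $\mathbb R$ for which $$k_0^i(a,b)=\tilde k^i(a,b)-\frac{\int \tilde k^i(a,w)\,P_{X_i}(dw)\int\tilde k^i(w,b)\,P_{X_i}(dw)}{\iint \tilde k^i(w,w')\,P_{X_i}(dw)P_{X_i}(dw')}$$ is well defined (the integrals exist, the denominator is nonzero). Put $k_v(s,t)=\sigma^2\prod_{i\in v}k_0^i(s_i,t_i)$ for $v\subseteq\{1,\dots,p\}$ and $k(x,x')=\sigma^2\prod_{i=1}^p(1+k_0^i(x_i,x_i'))$. Let $Z_0\sim\mathcal N(0,\sigma^2)$ and $Z_v\sim\mathrm{GP}(0,k_v)$, $v\in S$, be independent, and $Z(x)=Z_0+\sum_{v\in S}Z_v(x_v)$. Given design points $x^1,\dots,x^n\in\mathbb R^p$ such that $K_n=[k(x^j,x^l)]_{j,l}$ is invertible,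 observed outputs $y\in\mathbb R^n$ and a constant $f_0$, write $Z_n=(Z(x^1),\dots,Z(x^n))^T$, $k_n(x)=[k(x,x^j)]_j$, $k_{v,n}(x_v)=[k_v(x_v,x^j_v)]_j$, and define $$f^n(x)=f_0+k_n(x)^TK_n^{-1}(y-f_0\mathbf 1)-k_n(x)^TK_n^{-1}Z_n+Z(x),$$ $$f^n_v(x_v)=k_{v,n}(x_v)^TK_n^{-1}(y-f_0\mathbf 1)-k_{v,n}(x_v)^TK_n^{-1}Z_n+Z_v(x_v)\quad(v\in S),$$ and $f^n_{u^c}(x)=f^n(x)-f^n_u(x_u)$. Fix one realization of the processes and denote by $\tilde f^n,\tilde f^n_v,\tilde f^n_{u^c}$ the resulting functions. Assume that the $\tilde f^n_v(X_v)$ are measurable with $\mathbb E[\tilde f^n_v(X_v)^4]<\infty$ for all $v\in S$, and that $V(\tilde f^n(X))\ne0$. For $u\in S$ let $$s_u^f=\frac{V(\tilde f^n_u(X_u))+\mathrm{Cov}(\tilde f^n_u(X_u),\tilde f^n_{u^c}(X))}{V(\tilde f^n(X))},$$ and for independent copies $\tilde x^1,\tilde x^2,\dots$ of $X$ let $$s_{u,m}^f=\frac{\frac1m\sum_{j\le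 m}\tilde f^n_u(\tilde x^j_u)^2-\big(\bar f_u\big)^2+\frac1m\sum_{j\le m}\tilde f^n_u(\tilde x^j_u)\tilde f^n_{u^c}(\tilde x^j)-\bar f_u\,\bar f_{u^c}}{\frac1m\sum_{j\le m}\tilde f^n(\tilde x^j)^2-\big(\frac1m\sum_{j\le m}\tilde f^n(\tilde x^j)\big)^2},$$ where $\bar f_u=\frac1m\sum_{j\le m}\tilde f^n_u(\tilde x^j_u)$ and $\bar f_{u^c}=\frac1m\sum_{j\le m}\tilde f^n_{u^c}(\tilde x^j)$. Then for every $u\in S$, as $m\to\infty$, $$\sqrt m\,\big(s_{u,m}^f-s_u^f\big)\longrightarrow\mathcal N\big(0,\ \nabla\varphi(\mu)^T\,\Gamma\,\nabla\varphi(\mu)\big)\quad\text{in distribution,}$$ where $\mu$ and $\Gamma$ are the mean vector and the covariance matrix of $$U=\big(\tilde f^n_u(X_u),\ \tilde f^n_{u^c}(X),\ \tilde f^n(X),\ \tilde f^n_u(X_u)^2,\ \tilde f^n(X)^2,\ \tilde f^n_u(X_u)\tilde f^n_{u^c}(X)\big)$$ and $\varphi(u_1,\dots,u_6)=\dfrac{u_4-u_1^2+u_6-u_1u_2}{u_5-u_3^2}$.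 (In particular $U$ has finite second moments, $\varphi$ is differentiable at $\mu$, and the limit variance is nonnegative.) -/

import Mathlib

open MeasureTheory ProbabilityTheory Filter Matrix
open scoped Topology

namespace GPSens

noncomputable section

/-! ### Gaussian processes with prescribed covariance -/

/-- `Y ∼ GP(0, k)` under `P`: a centered Gaussian process, indexed by `T`, whose covariance kernel
is `k`. -/
structure IsCenteredGP {Ω T : Type*} [MeasurableSpace Ω] (Y : T → Ω → ℝ) (k : T → T → ℝ)
    (P : Measure Ω) : Prop where
  gaussian : IsGaussianProcess Y P
  mean_eq_zero : ∀ t, ∫ ω, Y t ω ∂P = 0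
  cov_eq : ∀ s t, cov[Y s, Y t; P] = k s t

/-! ### The covariance kernel

`PX` is the law of the input vector `X = (X_1, …, X_p)`, and `kt i` is the kernel `k̃^i` that is
given in the `i`-th direction. -/

section Kernel

variable {p : ℕ} (PX : Measure (Fin p → ℝ)) (kt : Fin p → ℝ → ℝ → ℝ) (σ : ℝ)

/-- The law of `X_i`. -/
def marginal (i : Fin p) : Measure ℝ := PX.map (fun x ↦ x i)

/-- The double integral `∫∫ k̃^i(w, w') P_{X_i}(dw) P_{X_i}(dw')`. -/
def kernelMass (i : Fin p) : ℝ := ∫ w, ∫ w', kt i w w' ∂(marginal PX i) ∂(marginal PX i)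

/-- The centered kernel `k_0^i`. -/
def k0 (i : Fin p) (a b : ℝ) : ℝ :=
  kt i a b -
    (∫ w, kt i a w ∂(marginal PX i)) * (∫ w, kt i w b ∂(marginal PX i)) / kernelMass PX kt i

/-- `k̃^i` is a covariance kernel, and the centered kernel `k_0^i` that is built from it is well
defined: the integrals exist and the denominator does not vanish. -/
structure AdmissibleKernel (i : Fin p) : Prop where
  posSemidef : (Matrix.of (kt i)).PosSemidef
  integrable_section : ∀ a, Integrable (kt i a) (marginal PX i)
  integrable : Integrable (fun w : ℝ × ℝ ↦ kt i w.1 w.2) ((marginal PX i).prod (marginal PX i))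
  kernelMass_ne_zero : kernelMass PX kt i ≠ 0

/-- `σ² ∏_{i ∈ v} k_0^i(s_i, t_i)`, the kernel of the component `Z_v`. For `v = ∅` it is the
constant `σ²`. -/
def kerOn (v : Finset (Fin p)) (s t : v → ℝ) : ℝ := σ ^ 2 * ∏ i : v, k0 PX kt i (s i) (t i)

/-- `k(x, x') = σ² ∏_i (1 + k_0^i(x_i, x'_i))`. -/
def anovaKer (x x' : Fin p → ℝ) : ℝ := σ ^ 2 * ∏ i, (1 + k0 PX kt i (x i) (x' i))

/-- The covariance matrix `K_n = [k(x^j, x^l)]` of the design `x^1, …, x^n`. -/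
def gram {n : ℕ} (D : Fin n → Fin p → ℝ) : Matrix (Fin n) (Fin n) ℝ :=
  Matrix.of fun j l ↦ anovaKer PX kt σ (D j) (D l)

end Kernel

/-! ### The conditional process and its components

`D` is the experimental design, `y` the vector of the outputs observed on it, and `f0` the constant
prior mean. The component `Z_v` is a process indexed by the vectors `x_v = (x_i)_{i ∈ v}`; `Z ∅` is
the random variable `Z_0` (its index set has a single element). -/

section Conditional

variable {p n : ℕ} {ΩZ : Type*}

/-- The process `Z(x) = Z_0 + ∑_{∅ ≠ v} Z_v(x_v)`. -/
def totalProcess (Z : (v : Finset (Fin p)) → (v → ℝ) → ΩZ → ℝ) (x : Fin p → ℝ) (ω : ΩZ) : ℝ :=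
  Z ∅ ((∅ : Finset (Fin p)).restrict x) ω +
    ∑ v ∈ Finset.univ.filter (fun v : Finset (Fin p) ↦ v.Nonempty), Z v (v.restrict x) ω

variable (PX : Measure (Fin p → ℝ)) (kt : Fin p → ℝ → ℝ → ℝ) (σ : ℝ)
  (D : Fin n → Fin p → ℝ) (y : Fin n → ℝ) (f0 : ℝ)
  (Z : (v : Finset (Fin p)) → (v → ℝ) → ΩZ → ℝ)

/-- The predictive mean `μ(x) = f_0 + ᵗk_n(x) K_n⁻¹ (y - f_0 𝟏)`. -/
def predMean (x : Fin p → ℝ) : ℝ :=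
  f0 + (fun j ↦ anovaKer PX kt σ x (D j)) ⬝ᵥ ((gram PX kt σ D)⁻¹ *ᵥ (fun j ↦ y j - f0))

/-- The component `μ_v(x_v)` of the predictive mean, for `v ≠ ∅`. -/
def predMeanOn (v : Finset (Fin p)) (t : v → ℝ) : ℝ :=
  (fun j ↦ kerOn PX kt σ v t (v.restrict (D j))) ⬝ᵥ
    ((gram PX kt σ D)⁻¹ *ᵥ (fun j ↦ y j - f0))

/-- The process `f^n(x) = μ(x) - ᵗk_n(x) K_n⁻¹ Z_n + Z(x)`, where `Z_n = (Z(x^1), …, Z(x^n))`. -/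
def condProcess (x : Fin p → ℝ) (ω : ΩZ) : ℝ :=
  predMean PX kt σ D y f0 x
    - (fun j ↦ anovaKer PX kt σ x (D j)) ⬝ᵥ
        ((gram PX kt σ D)⁻¹ *ᵥ (fun j ↦ totalProcess Z (D j) ω))
    + totalProcess Z x ω

/-- The component `f^n_v(x_v)` of `f^n`, for `v ≠ ∅`. -/
def condComponent (v : Finset (Fin p)) (t : v → ℝ) (ω : ΩZ) : ℝ :=
  predMeanOn PX kt σ D y f0 v t
    - (fun j ↦ kerOn PX kt σ v t (v.restrict (D j))) ⬝ᵥ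
        ((gram PX kt σ D)⁻¹ *ᵥ (fun j ↦ totalProcess Z (D j) ω))
    + Z v t ω

end Conditional

/-! ### The sensitivity index and its Monte Carlo estimator

Here `fu`, `fc`, `f` stand for realizations of `f^n_u`, `f^n_{u^c}` and `f^n`, seen as functions of
the input vector. -/

section Index

variable {E : Type*} (fu fc f : E → ℝ)

/-- The sensitivity index `(V(f_u(X)) + Cov(f_u(X), f_{u^c}(X))) / V(f(X))`, for `X ∼ PX`. -/
def sensIndex [MeasurableSpace E] (PX : Measure E) : ℝ :=
  (Var[fu; PX] + cov[fu, fc; PX]) / Var[f; PX]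

/-- The empirical mean of `g` over the first `m` sample points. -/
def empMean (g : E → ℝ) (x : ℕ → E) (m : ℕ) : ℝ := (1 / (m : ℝ)) * ∑ j ∈ Finset.range m, g (x j)

/-- The Monte Carlo estimator of the sensitivity index from the first `m` sample points. -/
def sensEstimator (x : ℕ → E) (m : ℕ) : ℝ :=
  (empMean (fun z ↦ fu z ^ 2) x m - empMean fu x m ^ 2
      + empMean (fun z ↦ fu z * fc z) x m - empMean fu x m * empMean fc x m)
    / (empMean (fun z ↦ f z ^ 2) x m - empMean f x m ^ 2)

/-- The vector `U = (f_u, f_{u^c}, f, f_u², f², f_u f_{u^c})`. -/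
def vecU (z : E) : EuclideanSpace ℝ (Fin 6) :=
  !₂[fu z, fc z, f z, fu z ^ 2, f z ^ 2, fu z * fc z]

/-- The mean vector of `U`. -/
def meanU [MeasurableSpace E] (PX : Measure E) : EuclideanSpace ℝ (Fin 6) :=
  WithLp.toLp 2 fun i ↦ ∫ z, vecU fu fc f z i ∂PX

/-- The covariance matrix of `U`. -/
def covU [MeasurableSpace E] (PX : Measure E) : Matrix (Fin 6) (Fin 6) ℝ :=
  Matrix.of fun i j ↦ cov[fun z ↦ vecU fu fc f z i, fun z ↦ vecU fu fc f z j; PX]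

/-- `φ(u_1, …, u_6) = (u_4 - u_1² + u_6 - u_1 u_2) / (u_5 - u_3²)`; coordinates are numbered from
`0` here. -/
def phi (w : EuclideanSpace ℝ (Fin 6)) : ℝ :=
  (w 3 - w 0 ^ 2 + w 5 - w 0 * w 1) / (w 4 - w 2 ^ 2)

/-- The asymptotic variance `ᵗ∇φ(μ) Γ ∇φ(μ)`. -/
def asympVar [MeasurableSpace E] (PX : Measure E) : ℝ :=
  (gradient phi (meanU fu fc f PX)).ofLp ⬝ᵥ
    (covU fu fc f PX *ᵥ (gradient phi (meanU fu fc f PX)).ofLp)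

end Index

end

end GPSens

/-! The proof is a delta method. The estimator is `phi` of the empirical means of the six
coordinates of `vecU`, and the index is `phi` of their expectations (`sensEstimator_eq_phi`,
`sensIndex_eq_phi`).

A scalar central limit theorem suffices, because `phi` is a quotient of quadratic polynomials and
has an exact expansion (`phi_sub_phi`): a linear form in the deviations plus three multiples of
squared deviations, all multiplied by a ratio of denominators. The linear form is the centred
empirical mean of one real function, so it is asymptotically normal after scaling by `√m`. The
squares vanish in probability after the same scaling (`tendstoInMeasure_sqrt_mul_sq`), the ratio
tends to `1` almost surely, and Slutsky's lemma concludes.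

Square integrability of `vecU` comes from fourth moments. Those of `f` follow from those of the
components, since the product kernel expands over subsets and makes `f` their sum plus a constant
(`condProcess_eq_sum`). -/

namespace GPSens

/-! ### Empirical means of an i.i.d. sample: strong law, variance, central limit theorem. -/

section Sample

variable {E Ω : Type*} [MeasurableSpace E] [MeasurableSpace Ω] {PX : Measure E} {P : Measure Ω}
  {X : ℕ → Ω → E}

lemma iIndepFun_comp_sample (hX : ∀ j, HasLaw (X j) PX P) (hXindep : iIndepFun X P) {g : E → ℝ}
    (hg : AEMeasurable g PX) : iIndepFun (fun j ω ↦ g (X j ω)) P :=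
  hXindep.comp₀ (fun _ ↦ g) (fun j ↦ (hX j).aemeasurable) (fun j ↦ (hX j).map_eq ▸ hg)

lemma aemeasurable_comp_sample (hX : ∀ j, HasLaw (X j) PX P) {g : E → ℝ}
    (hg : AEMeasurable g PX) (j : ℕ) : AEMeasurable (fun ω ↦ g (X j ω)) P :=
  AEMeasurable.comp_aemeasurable ((hX j).map_eq ▸ hg) (hX j).aemeasurable

lemma identDistrib_comp_sample (hX : ∀ j, HasLaw (X j) PX P) {g : E → ℝ}
    (hg : AEMeasurable g PX) (i j : ℕ) :
    IdentDistrib (fun ω ↦ g (X i ω)) (fun ω ↦ g (X j ω)) P P :=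
  ((hX i).identDistrib (hX j)).comp_of_aemeasurable ((hX i).map_eq ▸ hg)

lemma memLp_comp_sample (hX : ∀ j, HasLaw (X j) PX P) {g : E → ℝ} {q : ENNReal}
    (hg : MemLp g q PX) (j : ℕ) : MemLp (fun ω ↦ g (X j ω)) q P :=
  MemLp.comp_of_map ((hX j).map_eq ▸ hg) (hX j).aemeasurable

lemma aemeasurable_empMean (hX : ∀ j, HasLaw (X j) PX P) {g : E → ℝ}
    (hg : AEMeasurable g PX) (m : ℕ) : AEMeasurable (fun ω ↦ empMean g (fun j ↦ X j ω) m) P :=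
  (Finset.aemeasurable_fun_sum _ fun j _ ↦ aemeasurable_comp_sample hX hg j).const_mul _

lemma ae_tendsto_empMean (hX : ∀ j, HasLaw (X j) PX P) (hXindep : iIndepFun X P) {g : E → ℝ}
    (hg : Integrable g PX) :
    ∀ᵐ ω ∂P, Tendsto (fun m ↦ empMean g (fun j ↦ X j ω) m) atTop (𝓝 (∫ z, g z ∂PX)) := by
  have h := strong_law_ae_real (fun j ω ↦ g (X j ω))
    (memLp_one_iff_integrable.1 (memLp_comp_sample hX (memLp_one_iff_integrable.2 hg) 0))
    (fun i j hij ↦ (iIndepFun_comp_sample hX hXindep hg.aemeasurable).indepFun hij)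
    (fun i ↦ identDistrib_comp_sample hX hg.aemeasurable i 0)
  have hmean : ∫ ω, g (X 0 ω) ∂P = ∫ z, g z ∂PX := (hX 0).integral_comp hg.aestronglyMeasurable
  filter_upwards [h] with ω hω
  rw [hmean] at hω
  simpa only [empMean, one_div, ← div_eq_inv_mul] using hω

lemma variance_empMean (hX : ∀ j, HasLaw (X j) PX P) (hXindep : iIndepFun X P) {g : E → ℝ}
    (hg : MemLp g 2 PX) (m : ℕ) :
    Var[fun ω ↦ empMean g (fun j ↦ X j ω) m; P] = Var[g; PX] / m := by
  have hvar (j : ℕ) : Var[fun ω ↦ g (X j ω); P] = Var[g; PX] := by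
    have h := (hX j).covariance_fun_comp hg.aemeasurable hg.aemeasurable
    rwa [covariance_self (aemeasurable_comp_sample hX hg.aemeasurable j),
      covariance_self hg.aemeasurable] at h
  have hsum := IndepFun.variance_sum (μ := P) (X := fun j ω ↦ g (X j ω)) (s := Finset.range m)
    (fun j _ ↦ memLp_comp_sample hX hg j)
    (fun i _ j _ hij ↦ (iIndepFun_comp_sample hX hXindep hg.aemeasurable).indepFun hij)
  have hfun : (∑ j ∈ Finset.range m, fun ω ↦ g (X j ω))
      = fun ω ↦ ∑ j ∈ Finset.range m, g (X j ω) := by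
    ext ω; simp
  rw [hfun] at hsum
  simp only [empMean]
  rw [variance_const_mul, hsum]
  simp only [hvar, Finset.sum_const, Finset.card_range, nsmul_eq_mul]
  -- For `m = 0` both sides vanish because division by zero gives `0`.
  rcases Nat.eq_zero_or_pos m with rfl | hm
  · simp
  · have hm' : (m : ℝ) ≠ 0 := by exact_mod_cast hm.ne'
    field_simp

variable [IsProbabilityMeasure P]

lemma tendstoInDistribution_empMean (hX : ∀ j, HasLaw (X j) PX P) (hXindep : iIndepFun X P)
    {g : E → ℝ} (hg : MemLp g 2 PX) :
    TendstoInDistribution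
      (fun (m : ℕ) ω ↦ √(m : ℝ) * (empMean g (fun j ↦ X j ω) m - ∫ z, g z ∂PX))
      atTop id (fun _ ↦ P) (gaussianReal 0 (Var[g; PX]).toNNReal) := by
  have hmean : ∫ ω, g (X 0 ω) ∂P = ∫ z, g z ∂PX := (hX 0).integral_comp hg.aestronglyMeasurable
  have hvar : Var[fun ω ↦ g (X 0 ω); P] = Var[g; PX] := by
    have h := (hX 0).covariance_fun_comp hg.aemeasurable hg.aemeasurable
    rwa [covariance_self (aemeasurable_comp_sample hX hg.aemeasurable 0),
      covariance_self hg.aemeasurable] at h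
  have h := tendstoInDistribution_inv_sqrt_mul_sum_sub (P := P)
    (P' := gaussianReal 0 (Var[g; PX]).toNNReal) (Y := id) (X := fun j ω ↦ g (X j ω))
    (by rw [hvar]; exact HasLaw.id) (memLp_comp_sample hX hg 0)
    (iIndepFun_comp_sample hX hXindep hg.aemeasurable)
    (fun i ↦ identDistrib_comp_sample hX hg.aemeasurable i 0)
  convert h using 3 with m ω
  rw [hmean, empMean]
  rcases Nat.eq_zero_or_pos m with rfl | hm
  · simp
  have hm' : (0 : ℝ) < m := by exact_mod_cast hm
  have hs : √(m : ℝ) ≠ 0 := (Real.sqrt_pos.2 hm').ne'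
  have hsq : √(m : ℝ) ^ 2 = m := Real.sq_sqrt hm'.le
  field_simp
  rw [hsq]

lemma integral_empMean (hX : ∀ j, HasLaw (X j) PX P) {g : E → ℝ} (hg : MemLp g 2 PX) {m : ℕ}
    (hm : m ≠ 0) : ∫ ω, empMean g (fun j ↦ X j ω) m ∂P = ∫ z, g z ∂PX := by
  simp only [empMean]
  rw [integral_const_mul, integral_finsetSum _ fun j _ ↦
    (memLp_comp_sample hX hg j).integrable one_le_two]
  have hmean (j : ℕ) : ∫ ω, g (X j ω) ∂P = ∫ z, g z ∂PX :=
    (hX j).integral_comp hg.aestronglyMeasurable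
  have : (m : ℝ) ≠ 0 := by exact_mod_cast hm
  simp [hmean, this]

/-- The empirical mean has variance `Var[g] / m`, and `√m * t ^ 2 ≥ ε` means `|t| ≥ √(ε / √m)`.
Chebyshev's inequality at that level bounds the probability by `Var[g] / (ε * √m)`. -/
lemma tendstoInMeasure_sqrt_mul_sq (hX : ∀ j, HasLaw (X j) PX P) (hXindep : iIndepFun X P)
    {g : E → ℝ} (hg : MemLp g 2 PX) :
    TendstoInMeasure P
      (fun (m : ℕ) ω ↦ √(m : ℝ) * (empMean g (fun j ↦ X j ω) m - ∫ z, g z ∂PX) ^ 2)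
      atTop (fun _ ↦ 0) := by
  rw [tendstoInMeasure_iff_norm]
  intro ε hε
  have hlim : Tendsto (fun m : ℕ ↦ ENNReal.ofReal (Var[g; PX] / ε * (√(m : ℝ))⁻¹)) atTop (𝓝 0) := by
    rw [← ENNReal.ofReal_zero]
    refine ENNReal.tendsto_ofReal ?_
    rw [← mul_zero (Var[g; PX] / ε)]
    exact (tendsto_inv_atTop_zero.comp
      (Real.tendsto_sqrt_atTop.comp tendsto_natCast_atTop_atTop)).const_mul _
  refine tendsto_of_tendsto_of_tendsto_of_le_of_le' tendsto_const_nhds hlim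
    (Eventually.of_forall fun _ ↦ zero_le) ?_
  filter_upwards [eventually_gt_atTop 0] with m hm
  have hm' : (0 : ℝ) < m := by exact_mod_cast hm
  have hs : 0 < √(m : ℝ) := Real.sqrt_pos.2 hm'
  have hsq : √(m : ℝ) ^ 2 = m := Real.sq_sqrt hm'.le
  have hc : 0 < ε / √(m : ℝ) := by positivity
  have hmem : MemLp (fun ω ↦ empMean g (fun j ↦ X j ω) m) 2 P :=
    (memLp_finsetSum _ fun j _ ↦ memLp_comp_sample hX hg j).const_mul _
  have hcheb := meas_ge_le_variance_div_sq hmem (Real.sqrt_pos.2 hc)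
  rw [integral_empMean hX hg hm.ne', variance_empMean hX hXindep hg, Real.sq_sqrt hc.le] at hcheb
  refine (measure_mono fun ω hω ↦ ?_).trans (hcheb.trans_eq ?_)
  · simp only [Set.mem_ofPred_eq, sub_zero, Real.norm_eq_abs, abs_mul, abs_pow, sq_abs,
      abs_of_pos hs] at hω ⊢
    rw [← Real.sqrt_sq_eq_abs]
    apply Real.sqrt_le_sqrt
    rw [div_le_iff₀ hs]
    linarith
  · congr 1
    field_simp
    rw [hsq]

end Sample

/-! ### Algebra and differentiation of `phi`; moments of `vecU`. -/

section Functional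

variable {E : Type*} {fu fc f : E → ℝ}

lemma empMean_linear (c : Fin 6 → ℝ) (x : ℕ → E) (m : ℕ) (g : Fin 6 → E → ℝ) :
    empMean (fun z ↦ ∑ i, c i * g i z) x m = ∑ i, c i * empMean (g i) x m := by
  simp only [empMean]
  rw [Finset.sum_comm, Finset.mul_sum]
  refine Finset.sum_congr rfl fun i _ ↦ ?_
  rw [← Finset.mul_sum]
  ring

/-- The gradient of `phi` at `w`. -/
noncomputable def gradPhi (w : EuclideanSpace ℝ (Fin 6)) : EuclideanSpace ℝ (Fin 6) :=
  !₂[(-2 * w 0 - w 1) / (w 4 - w 2 ^ 2), -w 0 / (w 4 - w 2 ^ 2),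
    2 * w 2 * (w 3 - w 0 ^ 2 + w 5 - w 0 * w 1) / (w 4 - w 2 ^ 2) ^ 2,
    1 / (w 4 - w 2 ^ 2), -(w 3 - w 0 ^ 2 + w 5 - w 0 * w 1) / (w 4 - w 2 ^ 2) ^ 2,
    1 / (w 4 - w 2 ^ 2)]

lemma hasGradientAt_phi {w : EuclideanSpace ℝ (Fin 6)} (hw : w 4 - w 2 ^ 2 ≠ 0) :
    HasGradientAt phi (gradPhi w) w := by
  have hp (i : Fin 6) : HasFDerivAt (fun v : EuclideanSpace ℝ (Fin 6) ↦ v i)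
      (EuclideanSpace.proj i : EuclideanSpace ℝ (Fin 6) →L[ℝ] ℝ) w :=
    (EuclideanSpace.proj i : EuclideanSpace ℝ (Fin 6) →L[ℝ] ℝ).hasFDerivAt
  have h := ((((hp 3).sub ((hp 0).pow 2)).add (hp 5)).sub ((hp 0).mul (hp 1))).mul
    ((hasDerivAt_inv hw).comp_hasFDerivAt w ((hp 4).sub ((hp 2).pow 2)))
  rw [hasGradientAt_iff_hasFDerivAt]
  refine HasFDerivAt.congr_fderiv h ?_
  ext v
  simp [gradPhi, PiLp.inner_apply, Fin.sum_univ_six]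
  field_simp
  ring

/-- A second order expansion of `phi`, with the remainder written with squares. -/
lemma phi_sub_phi {a w : EuclideanSpace ℝ (Fin 6)} (hw : w 4 - w 2 ^ 2 ≠ 0)
    (ha : a 4 - a 2 ^ 2 ≠ 0) :
    phi a - phi w =
      (∑ i, gradPhi w i * (a i - w i)
        + ((a 1 - w 1) ^ 2 / (4 * (w 4 - w 2 ^ 2))
          - (2 * (a 0 - w 0) + (a 1 - w 1)) ^ 2 / (4 * (w 4 - w 2 ^ 2))
          + (w 3 - w 0 ^ 2 + w 5 - w 0 * w 1) / (w 4 - w 2 ^ 2) ^ 2 * (a 2 - w 2) ^ 2))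
      * ((w 4 - w 2 ^ 2) / (a 4 - a 2 ^ 2)) := by
  -- With `d i = a i - w i`, the quadratic part of the numerator is `-d 0 ^ 2 - d 0 * d 1 = (d 1 ^ 2
  -- - (2 * d 0 + d 1) ^ 2) / 4`. Completing the square removes the cross term, so every remainder
  -- term is the square of a single centred empirical mean.
  simp [phi, gradPhi, Fin.sum_univ_six]
  field_simp
  ring

variable [MeasurableSpace E] {PX : Measure E}

/-- Bilinearity of the covariance. With the gradient as `c` it identifies the limit variance and
shows that it is nonnegative. -/
lemma variance_linear_vecU [IsProbabilityMeasure PX]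
    (hU : ∀ i, MemLp (fun z ↦ vecU fu fc f z i) 2 PX) (c : Fin 6 → ℝ) :
    Var[fun z ↦ ∑ i, c i * vecU fu fc f z i; PX] = c ⬝ᵥ (covU fu fc f PX *ᵥ c) := by
  rw [← covariance_self (memLp_finsetSum _ fun i _ ↦ (hU i).const_mul _).aemeasurable,
    covariance_fun_sum_fun_sum (fun i ↦ (hU i).const_mul _) (fun i ↦ (hU i).const_mul _)]
  simp only [dotProduct, mulVec, covU, Matrix.of_apply, Finset.mul_sum,
    covariance_const_mul_left, covariance_const_mul_right]
  refine Finset.sum_congr rfl fun i _ ↦ Finset.sum_congr rfl fun j _ ↦ by ring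

lemma memLp_mul_of_four {g h : E → ℝ} (hg : MemLp g 4 PX) (hh : MemLp h 4 PX) :
    MemLp (fun z ↦ g z * h z) 2 PX := by
  -- Hölder's inequality with `1/4 + 1/4 = 1/2`.
  have : ENNReal.HolderTriple 4 4 2 := ⟨by
    rw [← two_mul]
    rw [show (4 : ENNReal) = 2 * 2 by norm_num, ENNReal.mul_inv (by simp) (by simp), ← mul_assoc,
      ENNReal.mul_inv_cancel (by simp) (by simp), one_mul]⟩
  exact hh.mul' hg

lemma memLp_vecU [IsProbabilityMeasure PX] (hu : MemLp fu 4 PX) (hc : MemLp fc 4 PX)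
    (hf : MemLp f 4 PX) (i : Fin 6) : MemLp (fun z ↦ vecU fu fc f z i) 2 PX := by
  have h24 : (2 : ENNReal) ≤ 4 := by norm_num
  fin_cases i
  · exact hu.mono_exponent h24
  · exact hc.mono_exponent h24
  · exact hf.mono_exponent h24
  · simpa [vecU, pow_two] using memLp_mul_of_four hu hu
  · simpa [vecU, pow_two] using memLp_mul_of_four hf hf
  · simpa [vecU] using memLp_mul_of_four hu hc

end Functional

/-! ### Two forms of Slutsky's lemma. -/

section Slutsky

variable {Ω Ω' : Type*} [MeasurableSpace Ω] [MeasurableSpace Ω'] {P : Measure Ω} {P' : Measure Ω'}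
  [IsProbabilityMeasure P] [IsProbabilityMeasure P'] {A B : ℕ → Ω → ℝ} {Y : Ω' → ℝ}

lemma tendstoInDistribution_add_const_mul
    (hA : TendstoInDistribution A atTop Y (fun _ ↦ P) P')
    (hB : TendstoInMeasure P B atTop fun _ ↦ 0) (hBm : ∀ m, AEMeasurable (B m) P) (c : ℝ) :
    TendstoInDistribution (fun m ω ↦ A m ω + c * B m ω) atTop Y (fun _ ↦ P) P' := by
  simpa using hA.continuous_comp_prodMk_of_tendstoInMeasure_const
    (g := fun x : ℝ × ℝ ↦ x.1 + c * x.2) (by fun_prop) hB hBm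

lemma tendstoInDistribution_mul_of_ae_tendsto_one
    (hA : TendstoInDistribution A atTop Y (fun _ ↦ P) P')
    (hB : ∀ᵐ ω ∂P, Tendsto (fun m ↦ B m ω) atTop (𝓝 1)) (hBm : ∀ m, AEMeasurable (B m) P) :
    TendstoInDistribution (fun m ω ↦ A m ω * B m ω) atTop Y (fun _ ↦ P) P' := by
  simpa using hA.continuous_comp_prodMk_of_tendstoInMeasure_const
    (g := fun x : ℝ × ℝ ↦ x.1 * x.2) (by fun_prop)
    (tendstoInMeasure_of_tendsto_ae (fun m ↦ (hBm m).aestronglyMeasurable) hB) hBm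

end Slutsky

/-! ### The delta method for `phi`. -/

section DeltaMethod

variable {E : Type*} {fu fc f : E → ℝ}

/-- The vector of the empirical means of the coordinates of `vecU`. -/
noncomputable def empMeanU (fu fc f : E → ℝ) (x : ℕ → E) (m : ℕ) : EuclideanSpace ℝ (Fin 6) :=
  WithLp.toLp 2 fun i ↦ empMean (fun z ↦ vecU fu fc f z i) x m

lemma sensEstimator_eq_phi (x : ℕ → E) (m : ℕ) :
    sensEstimator fu fc f x m = phi (empMeanU fu fc f x m) := by
  simp [sensEstimator, phi, empMeanU, vecU]

variable [MeasurableSpace E] {PX : Measure E} [IsProbabilityMeasure PX]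

lemma meanU_denominator (hf : MemLp f 2 PX) :
    meanU fu fc f PX 4 - meanU fu fc f PX 2 ^ 2 = Var[f; PX] := by
  rw [variance_eq_sub hf]
  simp [meanU, vecU]

lemma sensIndex_eq_phi (hu : MemLp fu 2 PX) (hc : MemLp fc 2 PX) (hf : MemLp f 2 PX) :
    sensIndex fu fc f PX = phi (meanU fu fc f PX) := by
  rw [sensIndex, phi, meanU_denominator hf, variance_eq_sub hu, covariance_eq_sub hu hc]
  simp only [meanU, vecU, Pi.pow_apply, Pi.mul_apply]
  congr 1
  simp
  ring

variable {Ω : Type*} [MeasurableSpace Ω] {P : Measure Ω} [IsProbabilityMeasure P]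
  {X : ℕ → Ω → E}

/-- The delta method for the function `phi` of the empirical means of `vecU`. -/
theorem tendstoInDistribution_phi_empMeanU (hX : ∀ j, HasLaw (X j) PX P) (hXindep : iIndepFun X P)
    (hU : ∀ i, MemLp (fun z ↦ vecU fu fc f z i) 2 PX) (hvar : Var[f; PX] ≠ 0) :
    TendstoInDistribution
      (fun (m : ℕ) ω ↦ √(m : ℝ) * (phi (empMeanU fu fc f (fun j ↦ X j ω) m)
        - phi (meanU fu fc f PX)))
      atTop id (fun _ ↦ P)
      (gaussianReal 0 (gradPhi (meanU fu fc f PX) ⬝ᵥ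
        (covU fu fc f PX *ᵥ gradPhi (meanU fu fc f PX))).toNNReal) := by
  have hu : MemLp fu 2 PX := hU 0
  have hc : MemLp fc 2 PX := hU 1
  have hf : MemLp f 2 PX := hU 2
  set w := meanU fu fc f PX with hw
  let a : Ω → ℕ → EuclideanSpace ℝ (Fin 6) := fun ω m ↦ empMeanU fu fc f (fun j ↦ X j ω) m
  have hwD : w 4 - w 2 ^ 2 ≠ 0 := by rwa [hw, meanU_denominator hf]
  have ham (m : ℕ) (i : Fin 6) : AEMeasurable (fun ω ↦ a ω m i) P :=
    aemeasurable_empMean hX (hU i).aemeasurable m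
  have halim (i : Fin 6) : ∀ᵐ ω ∂P, Tendsto (fun m ↦ a ω m i) atTop (𝓝 (w i)) :=
    ae_tendsto_empMean hX hXindep ((hU i).integrable one_le_two)
  have hden : ∀ᵐ ω ∂P, Tendsto (fun m ↦ a ω m 4 - a ω m 2 ^ 2) atTop (𝓝 (w 4 - w 2 ^ 2)) := by
    filter_upwards [halim 4, halim 2] with ω h4 h2 using h4.sub (h2.pow 2)
  -- By linearity the sum is the centred empirical mean of `∑ i, gradPhi w i * vecU i`, to which the
  -- scalar central limit theorem applies.
  have hlin : TendstoInDistribution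
      (fun (m : ℕ) ω ↦ √(m : ℝ) * ∑ i, gradPhi w i * (a ω m i - w i)) atTop id (fun _ ↦ P)
      (gaussianReal 0 (gradPhi w ⬝ᵥ (covU fu fc f PX *ᵥ gradPhi w)).toNNReal) := by
    have h := tendstoInDistribution_empMean hX hXindep
      (memLp_finsetSum Finset.univ fun i _ ↦ (hU i).const_mul (gradPhi w i))
    rw [variance_linear_vecU hU] at h
    convert h using 4 with m ω
    rw [empMean_linear _ _ _ (fun i z ↦ vecU fu fc f z i),
      integral_finsetSum _ fun i _ ↦ ((hU i).integrable one_le_two).const_mul _,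
      ← Finset.sum_sub_distrib]
    refine Finset.sum_congr rfl fun i _ ↦ ?_
    rw [integral_const_mul, mul_sub]
    rfl
  have hsqm {g : E → ℝ} (hg : MemLp g 2 PX) (m : ℕ) : AEMeasurable
      (fun ω ↦ √(m : ℝ) * (empMean g (fun j ↦ X j ω) m - ∫ z, g z ∂PX) ^ 2) P :=
    (((aemeasurable_empMean hX hg.aemeasurable m).sub_const _).pow_const _).const_mul _
  have hs : MemLp (fun z ↦ 2 * fu z + fc z) 2 PX := (hu.const_mul 2).add hc
  -- The three squares of the expansion are those of the centred empirical means of `fc`, `2 * fu +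
  -- fc` and `f`; the last factor is the ratio of denominators.
  have hmain := tendstoInDistribution_mul_of_ae_tendsto_one
    (tendstoInDistribution_add_const_mul (tendstoInDistribution_add_const_mul
      (tendstoInDistribution_add_const_mul hlin
        (tendstoInMeasure_sqrt_mul_sq hX hXindep hc) (hsqm hc) (4 * (w 4 - w 2 ^ 2))⁻¹)
      (tendstoInMeasure_sqrt_mul_sq hX hXindep hs) (hsqm hs) (-(4 * (w 4 - w 2 ^ 2))⁻¹))
      (tendstoInMeasure_sqrt_mul_sq hX hXindep hf) (hsqm hf)
      ((w 3 - w 0 ^ 2 + w 5 - w 0 * w 1) / (w 4 - w 2 ^ 2) ^ 2))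
    (B := fun m ω ↦ (w 4 - w 2 ^ 2) / (a ω m 4 - a ω m 2 ^ 2))
    (by
      filter_upwards [hden] with ω h
      rw [← div_self hwD]
      exact (tendsto_const_nhds (x := w 4 - w 2 ^ 2)).div h hwD)
    (fun m ↦ ((ham m 4).sub ((ham m 2).pow_const 2)).const_div _)
  have hphim (m : ℕ) : AEMeasurable (fun ω ↦ √(m : ℝ) * (phi (a ω m) - phi w)) P := by
    have (i : Fin 6) := ham m i
    unfold phi
    fun_prop
  -- The expansion requires a nonzero empirical denominator, which fails for instance at `m = 1`.
  -- Almost surely it holds for all large `m`, so the difference from the expansion is eventually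
  -- zero and tends to `0` in probability.
  refine tendstoInDistribution_of_tendstoInMeasure_sub _ _ hmain
    (tendstoInMeasure_of_tendsto_ae
      (fun m ↦ ((hphim m).sub (hmain.forall_aemeasurable m)).aestronglyMeasurable) ?_) hphim
  filter_upwards [hden] with ω h
  refine tendsto_const_nhds.congr' ?_
  filter_upwards [h.eventually_ne hwD] with m hm
  have h0 : empMean fu (fun j ↦ X j ω) m - ∫ z, fu z ∂PX = a ω m 0 - w 0 := rfl
  have h1 : empMean fc (fun j ↦ X j ω) m - ∫ z, fc z ∂PX = a ω m 1 - w 1 := rfl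
  have h2 : empMean f (fun j ↦ X j ω) m - ∫ z, f z ∂PX = a ω m 2 - w 2 := rfl
  have h01 : empMean (fun z ↦ 2 * fu z + fc z) (fun j ↦ X j ω) m
      - ∫ z, (2 * fu z + fc z) ∂PX = 2 * (a ω m 0 - w 0) + (a ω m 1 - w 1) := by
    rw [← h0, ← h1, integral_add ((hu.integrable one_le_two).const_mul 2)
      (hc.integrable one_le_two), integral_const_mul]
    simp only [empMean, Finset.sum_add_distrib, ← Finset.mul_sum]
    ring
  simp only [Pi.sub_apply, Pi.zero_apply]
  rw [h1, h2, h01, phi_sub_phi hwD hm]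
  ring

end DeltaMethod

/-! ### Decomposition of the conditional process into its components. -/

section Decomposition

variable {p n : ℕ} {ΩZ : Type*} (PX : Measure (Fin p → ℝ)) (kt : Fin p → ℝ → ℝ → ℝ) (σ : ℝ)
  (D : Fin n → Fin p → ℝ) (y : Fin n → ℝ) (f0 : ℝ)
  (Z : (v : Finset (Fin p)) → (v → ℝ) → ΩZ → ℝ)

/-- The product of the factors `1 + k0` expands into a sum over all subsets of coordinates; the
empty subset contributes `σ ^ 2`. -/
lemma anovaKer_eq_sum_kerOn (x x' : Fin p → ℝ) :
    anovaKer PX kt σ x x' = σ ^ 2 + ∑ v ∈ Finset.univ.filter (fun v : Finset (Fin p) ↦ v.Nonempty),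
      kerOn PX kt σ v (v.restrict x) (v.restrict x') := by
  have hker (v : Finset (Fin p)) : kerOn PX kt σ v (v.restrict x) (v.restrict x')
      = σ ^ 2 * ∏ i ∈ v, k0 PX kt i (x i) (x' i) := by
    rw [kerOn, ← Finset.prod_coe_sort v]
    rfl
  have hfilter : Finset.univ.filter (fun v : Finset (Fin p) ↦ v.Nonempty)
      = Finset.univ.erase ∅ := by
    ext v
    simp [Finset.nonempty_iff_ne_empty]
  rw [anovaKer, Finset.prod_one_add, Finset.powerset_univ, hfilter,
    ← Finset.add_sum_erase _ _ (Finset.mem_univ ∅), Finset.prod_empty, mul_add, mul_one,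
    Finset.mul_sum]
  simp only [hker]

lemma anovaKer_dotProduct (x : Fin p → ℝ) (b : Fin n → ℝ) :
    (fun j ↦ anovaKer PX kt σ x (D j)) ⬝ᵥ b = σ ^ 2 * ∑ j, b j
      + ∑ v ∈ Finset.univ.filter (fun v : Finset (Fin p) ↦ v.Nonempty),
        (fun j ↦ kerOn PX kt σ v (v.restrict x) (v.restrict (D j))) ⬝ᵥ b := by
  simp only [dotProduct, anovaKer_eq_sum_kerOn, add_mul, Finset.sum_add_distrib, Finset.sum_mul,
    Finset.mul_sum]
  rw [Finset.sum_comm]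

/-- The process `f^n` is the sum of its components and of a term that does not depend on the
input. -/
lemma condProcess_eq_sum (x : Fin p → ℝ) (ω : ΩZ) :
    condProcess PX kt σ D y f0 Z x ω =
      (f0 + σ ^ 2 * ∑ j, ((gram PX kt σ D)⁻¹ *ᵥ (fun j ↦ y j - f0)) j
        - σ ^ 2 * ∑ j, ((gram PX kt σ D)⁻¹ *ᵥ (fun j ↦ totalProcess Z (D j) ω)) j
        + Z ∅ 0 ω)
      + ∑ v ∈ Finset.univ.filter (fun v : Finset (Fin p) ↦ v.Nonempty),
        condComponent PX kt σ D y f0 Z v (v.restrict x) ω := by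
  -- Functions on the empty index set are all equal, so the `Z ∅` term does not depend on `x`.
  have hempty : (∅ : Finset (Fin p)).restrict x = 0 := by
    ext i
    exact absurd i.2 (Finset.notMem_empty _)
  have htotal : totalProcess Z x ω = Z ∅ 0 ω
      + ∑ v ∈ Finset.univ.filter (fun v : Finset (Fin p) ↦ v.Nonempty),
        Z v (v.restrict x) ω := by
    rw [totalProcess, hempty]
  simp only [condProcess, predMean, condComponent, predMeanOn]
  rw [anovaKer_dotProduct, anovaKer_dotProduct, htotal, Finset.sum_add_distrib,
    Finset.sum_sub_distrib]
  ring

/-- The process `f^n` is in `L^q` as soon as its components are. -/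
lemma memLp_condProcess [IsProbabilityMeasure PX] {q : ENNReal} {ω : ΩZ}
    (hmom : ∀ v : Finset (Fin p), v.Nonempty →
      MemLp (fun x ↦ condComponent PX kt σ D y f0 Z v (v.restrict x) ω) q PX) :
    MemLp (fun x ↦ condProcess PX kt σ D y f0 Z x ω) q PX := by
  have hsum := memLp_finsetSum (Finset.univ.filter fun v : Finset (Fin p) ↦ v.Nonempty)
    fun v hv ↦ hmom v (Finset.mem_filter.1 hv).2
  have hconst (c : ℝ) := (memLp_const (μ := PX) (p := q) c).add hsum
  exact (hconst _).ae_eq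
    (Eventually.of_forall fun x ↦ (condProcess_eq_sum PX kt σ D y f0 Z x ω).symm)

end Decomposition

end GPSens

theorem proposition4 {p n : ℕ}
    -- the law of the input vector
    (PX : Measure (Fin p → ℝ)) [IsProbabilityMeasure PX] (hPX : PX ≪ volume)
    -- the Gaussian process model: kernels, design, observed outputs, prior mean
    (kt : Fin p → ℝ → ℝ → ℝ) (hkt : ∀ i, GPSens.AdmissibleKernel PX kt i) (σ : ℝ)
    (D : Fin n → Fin p → ℝ) (hD : IsUnit (GPSens.gram PX kt σ D).det)
    (y : Fin n → ℝ) (f0 : ℝ)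
    -- the independent Gaussian processes `Z_v` (with `Z_∅ = Z_0`)
    {ΩZ : Type*} [MeasurableSpace ΩZ] (PZ : Measure ΩZ) [IsProbabilityMeasure PZ]
    (Z : (v : Finset (Fin p)) → (v → ℝ) → ΩZ → ℝ)
    (hZ : ∀ v, GPSens.IsCenteredGP (Z v) (GPSens.kerOn PX kt σ v) PZ)
    (hZindep : iIndepFun (fun v ω t ↦ Z v t ω) PZ)
    -- the Monte Carlo sample: independent copies of the input vector
    {Ω : Type*} [MeasurableSpace Ω] (P : Measure Ω) [IsProbabilityMeasure P]
    (X : ℕ → Ω → Fin p → ℝ) (hX : ∀ j, HasLaw (X j) PX P) (hXindep : iIndepFun X P)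
    -- one realization of the processes, with finite fourth moments
    (ω : ΩZ)
    (hmom : ∀ v : Finset (Fin p), v.Nonempty →
      MemLp (fun x ↦ GPSens.condComponent PX kt σ D y f0 Z v (v.restrict x) ω) 4 PX)
    (hvar : Var[fun x ↦ GPSens.condProcess PX kt σ D y f0 Z x ω; PX] ≠ 0)
    -- a group of variables, and the realizations of `f^n_u`, `f^n` and `f^n_{u^c} = f^n - f^n_u`
    (u : Finset (Fin p)) (hu : u.Nonempty) (fu f fc : (Fin p → ℝ) → ℝ)
    (hfu : ∀ x, fu x = GPSens.condComponent PX kt σ D y f0 Z u (u.restrict x) ω)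
    (hf : ∀ x, f x = GPSens.condProcess PX kt σ D y f0 Z x ω)
    (hfc : ∀ x, fc x = f x - fu x) :
    -- the mean, the covariance and the gradient in the limit law are well defined
    (∀ i, MemLp (fun x ↦ GPSens.vecU fu fc f x i) 2 PX) ∧
    DifferentiableAt ℝ GPSens.phi (GPSens.meanU fu fc f PX) ∧
    0 ≤ GPSens.asympVar fu fc f PX ∧
    -- asymptotic normality
    TendstoInDistribution
      (fun (m : ℕ) (ω' : Ω) ↦
        √(m : ℝ) * (GPSens.sensEstimator fu fc f (fun j ↦ X j ω') m
          - GPSens.sensIndex fu fc f PX))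
      atTop id (fun _ ↦ P) (gaussianReal 0 (GPSens.asympVar fu fc f PX).toNNReal) := by

  have hfu4 : MemLp fu 4 PX := by
    rw [funext hfu]
    exact hmom u hu
  have hf4 : MemLp f 4 PX := by
    rw [funext hf]
    exact GPSens.memLp_condProcess PX kt σ D y f0 Z hmom
  have hfc4 : MemLp fc 4 PX := by
    rw [funext hfc]
    exact hf4.sub hfu4
  have hU := GPSens.memLp_vecU hfu4 hfc4 hf4
  have hfu2 : MemLp fu 2 PX := hU 0
  have hfc2 : MemLp fc 2 PX := hU 1
  have hf2 : MemLp f 2 PX := hU 2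
  have hvarf : Var[f; PX] ≠ 0 := by rwa [funext hf]
  have hgrad := GPSens.hasGradientAt_phi (w := GPSens.meanU fu fc f PX)
    (by rwa [GPSens.meanU_denominator hf2])
  refine ⟨hU, hgrad.differentiableAt, ?_, ?_⟩
  -- The quadratic form is the variance of a real function, hence nonnegative.
  · rw [GPSens.asympVar, ← GPSens.variance_linear_vecU hU]
    exact variance_nonneg _ _
  · simp only [GPSens.asympVar, hgrad.gradient, GPSens.sensEstimator_eq_phi,
      GPSens.sensIndex_eq_phi hfu2 hfc2 hf2]
    exact GPSens.tendstoInDistribution_phi_empMeanU hX hXindep hU hvarf
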